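/- A permutation tableau is a Ferrers diagram of a partition into non-negative parts (a part equal to $0$ gives an empty row, and rows are weakly decreasing in length from top to bottom) whose boxes are filled with $0$s and $1$s such that (1) each column contains at least one $1$, and (2) no $0$ has both a $1$ above it in the same column and a $1$ to its left in the same row. Its length is the number of its rows plus the number of its columns. For $n\ge 0$ let $R_n$ and $C_n$ denote the number of rows and the number of columns, respectively, of a uniformly random permutation tableau of length $n$. Then for every $n\ge 1$ $$C_n \overset{d}{=} R_n-1 ,$$ and $C_n$ has the same distribution as the number of descents, and also as the number of ascents, of a uniformly random permutation $\sigma$ of $\{1,\dots,n\}$ (a descent, resp. ascent, is a position $1\le i<n$ with $\sigma_i>\sigma_{i+1}$, resp. $\sigma_i<\sigma_{i+1}$). Moreover, as $n\to\infty$, $$\frac{C_n-(n-1)/2}{\sqrt{(n+1)/12}} \overset{d}{\longrightarrow} N(0,1).$$ -/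

import Mathlib

open MeasureTheory ProbabilityTheory Filter

/-- A permutation tableau. The Ferrers diagram of a partition into `numRows` nonnegative parts is
given by a Young diagram `shape` (cells `(i, j)` in row `i` from the top and column `j` from the
left, both counted from `0`) together with the total number of rows `numRows`; the rows
`i < numRows` outside of `shape` are the empty rows (parts equal to `0`). The filling of the boxes
by `0`s and `1`s is given by the finite set `ones` of the boxes that hold a `1`. -/
@[ext]
structure PermutationTableau where
  shape : YoungDiagram
  numRows : ℕ
  colLen_le_numRows : shape.colLen 0 ≤ numRows
  ones : Finset (ℕ × ℕ)
  ones_subset : ones ⊆ shape.cells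
  /-- Each column contains at least one `1`. -/
  exists_one_in_col : ∀ j < shape.rowLen 0, ∃ i, (i, j) ∈ ones
  /-- No `0` has a `1` above it in the same column and a `1` to its left in the same row. -/
  no_bad_zero : ∀ i j, (i, j) ∈ shape → (i, j) ∉ ones →
    ¬ ((∃ i' < i, (i', j) ∈ ones) ∧ (∃ j' < j, (i, j') ∈ ones))

namespace PermutationTableau

/-- The number of columns, i.e. the length of the top row. -/
def numCols (T : PermutationTableau) : ℕ := T.shape.rowLen 0

/-- The length: number of rows plus number of columns. -/
def length (T : PermutationTableau) : ℕ := T.numRows + T.numCols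

/-- The set of all permutation tableaux of length `n`. -/
def ofLength (n : ℕ) : Set PermutationTableau := {T | T.length = n}

lemma mem_range_of_mem_shape (T : PermutationTableau) {c : ℕ × ℕ} (hc : c ∈ T.shape.cells) :
    c ∈ Finset.range T.length ×ˢ Finset.range T.length := by
  obtain ⟨i, j⟩ := c
  have hc' : (i, j) ∈ T.shape := hc
  have h1 : i < T.shape.colLen 0 :=
    YoungDiagram.mem_iff_lt_colLen.mp (T.shape.up_left_mem le_rfl (Nat.zero_le j) hc')
  have h2 : j < T.shape.rowLen 0 :=
    YoungDiagram.mem_iff_lt_rowLen.mp (T.shape.up_left_mem (Nat.zero_le i) le_rfl hc')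
  have h3 := T.colLen_le_numRows
  simp only [Finset.mem_product, Finset.mem_range, length, numCols]
  omega

lemma finite_ofLength (n : ℕ) : (ofLength n).Finite := by
  let f : PermutationTableau → Finset (ℕ × ℕ) × ℕ × Finset (ℕ × ℕ) :=
    fun T => (T.shape.cells, T.numRows, T.ones)
  have hf : Function.Injective f := by
    intro S T h
    simp only [f, Prod.mk.injEq] at h
    exact PermutationTableau.ext (YoungDiagram.ext h.1) h.2.1 h.2.2
  let B := Finset.range n ×ˢ Finset.range n
  refine Set.Finite.of_finite_image (f := f) (Set.Finite.subset
    (Finset.finite_toSet (B.powerset ×ˢ Finset.range (n + 1) ×ˢ B.powerset)) ?_) hf.injOn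
  rintro _ ⟨T, hT, rfl⟩
  have hT' : T.length = n := hT
  have hB : T.shape.cells ⊆ B := fun c hc => by
    have := T.mem_range_of_mem_shape hc
    rwa [hT'] at this
  have hr : T.numRows < n + 1 := by
    simp only [length] at hT'
    omega
  simp only [f, Finset.mem_coe, Finset.mem_product, Finset.mem_powerset, Finset.mem_range]
  exact ⟨hB, hr, T.ones_subset.trans hB⟩

lemma nonempty_ofLength (n : ℕ) : (ofLength n).Nonempty := by
  have h0 : (⊥ : YoungDiagram).rowLen 0 = 0 := by
    by_contra h
    exact YoungDiagram.notMem_bot _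
      (YoungDiagram.mem_iff_lt_rowLen.mpr (Nat.pos_of_ne_zero h))
  have h1 : (⊥ : YoungDiagram).colLen 0 = 0 := by
    by_contra h
    exact YoungDiagram.notMem_bot _
      (YoungDiagram.mem_iff_lt_colLen.mpr (Nat.pos_of_ne_zero h))
  exact ⟨⟨⊥, n, by omega, ∅, by simp, by simp [h0],
    fun i j h => absurd h (YoungDiagram.notMem_bot _)⟩, by simp [ofLength, length, numCols, h0]⟩

instance : MeasurableSpace PermutationTableau := ⊤

instance : DiscreteMeasurableSpace PermutationTableau := ⟨fun _ => trivial⟩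

/-- The uniform probability measure on the set of permutation tableaux of length `n`. -/
noncomputable def uniformMeasure (n : ℕ) : Measure PermutationTableau := uniformOn (ofLength n)

instance (n : ℕ) : IsProbabilityMeasure (uniformMeasure n) :=
  isProbabilityMeasure_uniformOn (finite_ofLength n) (nonempty_ofLength n)

end PermutationTableau

namespace RandomPermutation

instance (n : ℕ) : MeasurableSpace (Equiv.Perm (Fin n)) := ⊤

instance (n : ℕ) : DiscreteMeasurableSpace (Equiv.Perm (Fin n)) := ⟨fun _ => trivial⟩

/-- The uniform probability measure on the permutations of an `n`-element linearly ordered set. -/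
noncomputable def uniformMeasure (n : ℕ) : Measure (Equiv.Perm (Fin n)) := uniformOn Set.univ

instance (n : ℕ) : IsProbabilityMeasure (uniformMeasure n) :=
  isProbabilityMeasure_uniformOn Set.finite_univ Set.univ_nonempty

/-- The number of descents: positions `i` with `σ i > σ (i + 1)`. -/
def descents {n : ℕ} (σ : Equiv.Perm (Fin n)) : ℕ :=
  (Finset.univ.filter fun i : Fin n => ∃ j : Fin n, j.val = i.val + 1 ∧ σ j < σ i).card

/-- The number of ascents: positions `i` with `σ i < σ (i + 1)`. -/
def ascents {n : ℕ} (σ : Equiv.Perm (Fin n)) : ℕ :=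
  (Finset.univ.filter fun i : Fin n => ∃ j : Fin n, j.val = i.val + 1 ∧ σ i < σ j).card

end RandomPermutation

/-! Columns and descents share the Eulerian generating function `(1 - X)^(n+1) * ∑ (m+1)^n X^m`. For
tableaux, refine by the unrestricted rows, marked by `x`. A tableau of length `n + 1` either has an
empty bottom row, which can be deleted, or has a first column meeting every row. In the second case,
deleting that column leaves a tableau of length `n`, and the column is encoded by a nonempty set of
unrestricted rows of that tableau. The resulting recurrence `genFun_succ` couples `x` with `x + 1`;
`genFun_natCast` solves it at all positive integers, and `x = 1` forgets the refinement. For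
permutations, the refinement is by the first value (`genFunFirst_eq`).

Comparing coefficients identifies the laws of columns and descents. Reversing the values exchanges
descents and ascents. Since these add up to `n - 1` while rows and columns add up to `n`, the law of
rows follows.

For the limit, dividing the generating function by `1 - X` shows that the proportion of permutations
with at most `k` descents is the Irwin–Hall distribution function at `k + 1` (`card_descents_le`).
So descents are distributed as `⌈S⌉ - 1`, with `S` a sum of `n` independent uniform variables.
Rounding changes `S` by a bounded amount, so the central limit theorem for `S` and Slutsky's theorem
finish the proof. -/

/-! ### Adding and deleting the first column of a Young diagram. -/

/-- The map that moves a box one column to the right. -/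
def shiftRight : ℕ × ℕ ↪ ℕ × ℕ := ⟨fun c => (c.1, c.2 + 1), fun a b h => by
  rw [Prod.mk.injEq, Nat.add_right_cancel_iff] at h
  exact Prod.ext h.1 h.2⟩

@[simp]
lemma shiftRight_mk (i j : ℕ) : shiftRight (i, j) = (i, j + 1) := rfl

@[simp]
lemma mem_preimage_shiftRight {s : Finset (ℕ × ℕ)} {i j : ℕ} :
    (i, j) ∈ s.preimage shiftRight shiftRight.injective.injOn ↔ (i, j + 1) ∈ s := by
  rw [Finset.mem_preimage, shiftRight_mk]

@[simp]
lemma mem_map_shiftRight_succ {s : Finset (ℕ × ℕ)} {i j : ℕ} :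
    (i, j + 1) ∈ s.map shiftRight ↔ (i, j) ∈ s := by
  rw [← shiftRight_mk, Finset.mem_map']

namespace YoungDiagram

lemma rowLen_eq_of_forall_mem_iff {μ : YoungDiagram} {i k : ℕ}
    (h : ∀ j, (i, j) ∈ μ ↔ j < k) : μ.rowLen i = k := by
  have h1 := h k
  have h2 := h (μ.rowLen i)
  rw [mem_iff_lt_rowLen] at h1 h2
  omega

lemma colLen_eq_of_forall_mem_iff {μ : YoungDiagram} {j k : ℕ}
    (h : ∀ i, (i, j) ∈ μ ↔ i < k) : μ.colLen j = k := by
  have h1 := h k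
  have h2 := h (μ.colLen j)
  rw [mem_iff_lt_colLen] at h1 h2
  omega

/-- The Young diagram without its first column. -/
noncomputable def tailCols (μ : YoungDiagram) : YoungDiagram where
  cells := μ.cells.preimage shiftRight shiftRight.injective.injOn
  isLowerSet := by
    rintro ⟨i, j⟩ ⟨i', j'⟩ h hm
    rw [Finset.mem_coe, mem_preimage_shiftRight, mem_cells] at hm ⊢
    exact μ.up_left_mem h.1 (Nat.succ_le_succ h.2) hm

@[simp]
lemma mem_tailCols {μ : YoungDiagram} {i j : ℕ} : (i, j) ∈ μ.tailCols ↔ (i, j + 1) ∈ μ := by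
  rw [← mem_cells, tailCols, mem_preimage_shiftRight, mem_cells]

lemma rowLen_tailCols (μ : YoungDiagram) (i : ℕ) : μ.tailCols.rowLen i = μ.rowLen i - 1 :=
  rowLen_eq_of_forall_mem_iff fun j => by rw [mem_tailCols, mem_iff_lt_rowLen]; omega

/-- The Young diagram with an additional first column of length `r`. -/
noncomputable def consCol (μ : YoungDiagram) (r : ℕ) (h : μ.colLen 0 ≤ r) : YoungDiagram where
  cells := Finset.range r ×ˢ {0} ∪ μ.cells.map shiftRight
  isLowerSet := by
    rintro ⟨i, j⟩ ⟨i', j'⟩ hle hm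
    obtain ⟨h1 : i' ≤ i, h2 : j' ≤ j⟩ := hle
    rw [Finset.mem_coe, Finset.mem_union, Finset.mem_product] at hm ⊢
    rcases j with _ | j
    · have : i < r := by simpa using hm
      left
      simp only [Finset.mem_range, Finset.mem_singleton]
      omega
    · have hm' : (i, j) ∈ μ := by simpa using hm
      rcases j' with _ | j'
      · have := mem_iff_lt_colLen.1 (μ.up_left_mem le_rfl (Nat.zero_le j) hm')
        exact Or.inl ⟨Finset.mem_range.2 (by change i' < r; omega), Finset.mem_singleton.2 rfl⟩
      · right
        rw [mem_map_shiftRight_succ, mem_cells]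
        exact μ.up_left_mem h1 (Nat.le_of_succ_le_succ h2) hm'

@[simp]
lemma mem_consCol_zero {μ : YoungDiagram} {r i : ℕ} {h : μ.colLen 0 ≤ r} :
    (i, 0) ∈ μ.consCol r h ↔ i < r := by
  rw [← mem_cells, consCol]; simp

@[simp]
lemma mem_consCol_succ {μ : YoungDiagram} {r i j : ℕ} {h : μ.colLen 0 ≤ r} :
    (i, j + 1) ∈ μ.consCol r h ↔ (i, j) ∈ μ := by
  rw [← mem_cells, consCol]; simp

end YoungDiagram

/-! ### Recursive structure of permutation tableaux. -/

namespace PermutationTableau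

lemma lt_numRows (T : PermutationTableau) {i j : ℕ} (h : (i, j) ∈ T.shape) : i < T.numRows :=
  (YoungDiagram.mem_iff_lt_colLen.1 (T.shape.up_left_mem le_rfl (Nat.zero_le j) h)).trans_le
    T.colLen_le_numRows

lemma mem_shape_of_mem_ones (T : PermutationTableau) {i j : ℕ} (h : (i, j) ∈ T.ones) :
    (i, j) ∈ T.shape := (YoungDiagram.mem_cells _).1 (T.ones_subset h)

/-- The row `i` is unrestricted if none of its zeros has a one above it. -/
def IsUnrestricted (T : PermutationTableau) (i : ℕ) : Prop :=
  ∀ j, (i, j) ∈ T.shape → (∃ i' < i, (i', j) ∈ T.ones) → (i, j) ∈ T.ones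

open Classical in
/-- The set of unrestricted rows. -/
noncomputable def unrestrictedRows (T : PermutationTableau) : Finset ℕ :=
  (Finset.range T.numRows).filter T.IsUnrestricted

lemma mem_unrestrictedRows {T : PermutationTableau} {i : ℕ} :
    i ∈ T.unrestrictedRows ↔ i < T.numRows ∧ T.IsUnrestricted i := by
  simp [unrestrictedRows]

/-- Add an empty row at the bottom. -/
def addRow (T : PermutationTableau) : PermutationTableau :=
  { T with
    numRows := T.numRows + 1
    colLen_le_numRows := T.colLen_le_numRows.trans (Nat.le_succ _) }

lemma unrestrictedRows_addRow (T : PermutationTableau) :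
    T.addRow.unrestrictedRows = insert T.numRows T.unrestrictedRows := by
  ext i
  rw [Finset.mem_insert, mem_unrestrictedRows, mem_unrestrictedRows]
  change i < T.numRows + 1 ∧ T.IsUnrestricted i ↔ _
  constructor
  · rintro ⟨h1, h2⟩
    rcases Nat.lt_succ_iff_lt_or_eq.1 h1 with h | h
    · exact Or.inr ⟨h, h2⟩
    · exact Or.inl h
  · rintro (rfl | ⟨h1, h2⟩)
    · exact ⟨Nat.lt_succ_self _, fun j hj => absurd (T.lt_numRows hj) (lt_irrefl _)⟩
    · exact ⟨h1.trans (Nat.lt_succ_self _), h2⟩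

lemma card_unrestrictedRows_addRow (T : PermutationTableau) :
    T.addRow.unrestrictedRows.card = T.unrestrictedRows.card + 1 := by
  rw [unrestrictedRows_addRow, Finset.card_insert_of_notMem]
  simp [mem_unrestrictedRows]

/-- Delete the first column. -/
noncomputable def tailCols (T : PermutationTableau) : PermutationTableau where
  shape := T.shape.tailCols
  numRows := T.numRows
  colLen_le_numRows := by
    by_contra! h
    exact lt_irrefl _ (T.lt_numRows (YoungDiagram.mem_tailCols.1
      (YoungDiagram.mem_iff_lt_colLen.2 h)))
  ones := T.ones.preimage shiftRight shiftRight.injective.injOn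
  ones_subset := fun ⟨i, j⟩ h => by
    rw [YoungDiagram.mem_cells, YoungDiagram.mem_tailCols]
    exact T.mem_shape_of_mem_ones (mem_preimage_shiftRight.1 h)
  exists_one_in_col := fun j hj => by
    rw [YoungDiagram.rowLen_tailCols] at hj
    obtain ⟨i, hi⟩ := T.exists_one_in_col (j + 1) (by omega)
    exact ⟨i, mem_preimage_shiftRight.2 hi⟩
  no_bad_zero := by
    rintro i j h1 h2 ⟨⟨i', hi', h3⟩, ⟨j', hj', h4⟩⟩
    rw [mem_preimage_shiftRight] at h2 h3 h4
    exact T.no_bad_zero i (j + 1) (YoungDiagram.mem_tailCols.1 h1) h2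
      ⟨⟨i', hi', h3⟩, ⟨j' + 1, by omega, h4⟩⟩

@[simp]
lemma mem_ones_tailCols {T : PermutationTableau} {i j : ℕ} :
    (i, j) ∈ T.tailCols.ones ↔ (i, j + 1) ∈ T.ones := by
  rw [tailCols, mem_preimage_shiftRight]

lemma numCols_tailCols (T : PermutationTableau) : T.tailCols.numCols = T.numCols - 1 :=
  T.shape.rowLen_tailCols 0

/-- The set of rows that have a one in the first column. -/
noncomputable def firstCol (T : PermutationTableau) : Finset ℕ :=
  T.ones.preimage (fun i => (i, 0)) (Prod.mk_left_injective 0).injOn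

@[simp]
lemma mem_firstCol {T : PermutationTableau} {i : ℕ} : i ∈ T.firstCol ↔ (i, 0) ∈ T.ones := by
  rw [firstCol, Finset.mem_preimage]

/-- A one in the first column lies to the left of all other boxes of its row, so none of these can
be a zero below a one. -/
lemma firstCol_subset (T : PermutationTableau) : T.firstCol ⊆ T.tailCols.unrestrictedRows := by
  intro i hi
  rw [mem_firstCol] at hi
  refine mem_unrestrictedRows.2 ⟨T.lt_numRows (T.mem_shape_of_mem_ones hi), ?_⟩
  rintro j hj ⟨i', hi', h⟩
  by_contra hc
  rw [mem_ones_tailCols] at h hc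
  exact T.no_bad_zero i (j + 1) (YoungDiagram.mem_tailCols.1 hj) hc
    ⟨⟨i', hi', h⟩, ⟨0, j.succ_pos, hi⟩⟩

lemma firstCol_nonempty (T : PermutationTableau) (h : 0 < T.numCols) : T.firstCol.Nonempty := by
  obtain ⟨i, hi⟩ := T.exists_one_in_col 0 h
  exact ⟨i, mem_firstCol.2 hi⟩

/-- Add a first column that meets every row, with ones in the rows `S`. -/
noncomputable def consCol (T : PermutationTableau) (S : Finset ℕ) (hS : S ⊆ T.unrestrictedRows)
    (hne : S.Nonempty) : PermutationTableau where
  shape := T.shape.consCol T.numRows T.colLen_le_numRows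
  numRows := T.numRows
  colLen_le_numRows :=
    (YoungDiagram.colLen_eq_of_forall_mem_iff fun _ => YoungDiagram.mem_consCol_zero).le
  ones := S ×ˢ {0} ∪ T.ones.map shiftRight
  ones_subset := by
    rintro ⟨i, j⟩ h
    rw [YoungDiagram.mem_cells]
    rcases j with _ | j
    · rw [YoungDiagram.mem_consCol_zero]
      have : i ∈ S := by simpa using h
      exact (mem_unrestrictedRows.1 (hS this)).1
    · rw [YoungDiagram.mem_consCol_succ]
      exact T.mem_shape_of_mem_ones (by simpa using h)
  exists_one_in_col := by
    rintro (_ | j) hj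
    · obtain ⟨i, hi⟩ := hne
      exact ⟨i, by simpa using hi⟩
    · rw [← YoungDiagram.mem_iff_lt_rowLen, YoungDiagram.mem_consCol_succ,
        YoungDiagram.mem_iff_lt_rowLen] at hj
      obtain ⟨i, hi⟩ := T.exists_one_in_col j hj
      exact ⟨i, by simpa using hi⟩
  no_bad_zero := by
    rintro i (_ | j) h1 h2 ⟨⟨i', hi', h3⟩, ⟨j', hj', h4⟩⟩
    · omega
    · rw [YoungDiagram.mem_consCol_succ] at h1
      replace h2 : (i, j) ∉ T.ones := by simpa using h2
      replace h3 : (i', j) ∈ T.ones := by simpa using h3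
      rcases j' with _ | j'
      -- The one to the left is in the new column, so row `i` is unrestricted and has no zero below
      -- a one.
      · have : i ∈ S := by simpa using h4
        exact h2 ((mem_unrestrictedRows.1 (hS this)).2 j h1 ⟨i', hi', h3⟩)
      · exact T.no_bad_zero i j h1 h2 ⟨⟨i', hi', h3⟩, ⟨j', by omega, by simpa using h4⟩⟩

lemma mem_ones_consCol_zero {T : PermutationTableau} {S : Finset ℕ}
    {hS : S ⊆ T.unrestrictedRows} {hne : S.Nonempty} {i : ℕ} :
    (i, 0) ∈ (T.consCol S hS hne).ones ↔ i ∈ S := by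
  simp [consCol]

lemma mem_ones_consCol_succ {T : PermutationTableau} {S : Finset ℕ}
    {hS : S ⊆ T.unrestrictedRows} {hne : S.Nonempty} {i j : ℕ} :
    (i, j + 1) ∈ (T.consCol S hS hne).ones ↔ (i, j) ∈ T.ones := by
  simp [consCol]

lemma tailCols_consCol (T : PermutationTableau) (S : Finset ℕ)
    (hS : S ⊆ T.unrestrictedRows) (hne : S.Nonempty) : (T.consCol S hS hne).tailCols = T := by
  refine PermutationTableau.ext ?_ rfl ?_
  · ext ⟨i, j⟩
    rw [YoungDiagram.mem_cells, YoungDiagram.mem_cells]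
    exact YoungDiagram.mem_tailCols.trans
      (YoungDiagram.mem_consCol_succ (h := T.colLen_le_numRows))
  · ext ⟨i, j⟩
    rw [mem_ones_tailCols, mem_ones_consCol_succ]

lemma firstCol_consCol (T : PermutationTableau) (S : Finset ℕ)
    (hS : S ⊆ T.unrestrictedRows) (hne : S.Nonempty) : (T.consCol S hS hne).firstCol = S := by
  ext i
  rw [mem_firstCol, mem_ones_consCol_zero]

lemma colLen_consCol (T : PermutationTableau) (S : Finset ℕ)
    (hS : S ⊆ T.unrestrictedRows) (hne : S.Nonempty) :
    (T.consCol S hS hne).shape.colLen 0 = T.numRows :=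
  YoungDiagram.colLen_eq_of_forall_mem_iff fun _ =>
    YoungDiagram.mem_consCol_zero (h := T.colLen_le_numRows)

lemma numCols_consCol (T : PermutationTableau) (S : Finset ℕ)
    (hS : S ⊆ T.unrestrictedRows) (hne : S.Nonempty) :
    (T.consCol S hS hne).numCols = T.numCols + 1 := by
  refine YoungDiagram.rowLen_eq_of_forall_mem_iff fun j => ?_
  rcases j with _ | j
  · obtain ⟨i, hi⟩ := hne
    have := (mem_unrestrictedRows.1 (hS hi)).1
    exact (YoungDiagram.mem_consCol_zero (h := T.colLen_le_numRows)).trans (by omega)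
  · refine (YoungDiagram.mem_consCol_succ (h := T.colLen_le_numRows)).trans ?_
    rw [YoungDiagram.mem_iff_lt_rowLen, Nat.succ_lt_succ_iff]
    rfl

/-- Tableaux without empty rows are determined by their first column and the other columns. -/
lemma eq_of_tailCols_eq {S T : PermutationTableau} (hS : S.shape.colLen 0 = S.numRows)
    (hT : T.shape.colLen 0 = T.numRows) (h1 : S.tailCols = T.tailCols)
    (h2 : S.firstCol = T.firstCol) : S = T := by
  have hr : S.numRows = T.numRows :=
    (congrArg numRows h1 :)
  refine PermutationTableau.ext ?_ hr ?_
  · ext ⟨i, j⟩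
    rw [YoungDiagram.mem_cells, YoungDiagram.mem_cells]
    rcases j with _ | j
    · rw [YoungDiagram.mem_iff_lt_colLen, YoungDiagram.mem_iff_lt_colLen, hS, hT, hr]
    · have : (i, j) ∈ S.tailCols.shape ↔ (i, j) ∈ T.tailCols.shape := by rw [h1]
      exact YoungDiagram.mem_tailCols.symm.trans (this.trans YoungDiagram.mem_tailCols)
  · ext ⟨i, j⟩
    rcases j with _ | j
    · rw [← mem_firstCol, ← mem_firstCol, h2]
    · rw [← mem_ones_tailCols, ← mem_ones_tailCols, h1]

-- As the first column meets every row, it makes a row restricted exactly when it has a zero there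
-- below a one. All other restrictions are visible in `tailCols`.
open Classical in
lemma unrestrictedRows_eq_filter (T : PermutationTableau) (h : T.shape.colLen 0 = T.numRows) :
    T.unrestrictedRows = T.tailCols.unrestrictedRows.filter
      (fun i => i ∈ T.firstCol ∨ ∀ i' ∈ T.firstCol, i ≤ i') := by
  ext i
  rw [Finset.mem_filter, mem_unrestrictedRows, mem_unrestrictedRows]
  constructor
  · rintro ⟨h1, h2⟩
    refine ⟨⟨h1, fun j hj ⟨i', hi', hm⟩ => ?_⟩, ?_⟩
    · rw [mem_ones_tailCols] at hm ⊢
      exact h2 (j + 1) (YoungDiagram.mem_tailCols.1 hj) ⟨i', hi', hm⟩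
    · by_contra! hc
      obtain ⟨hc1, i', hc2, hc3⟩ := hc
      rw [mem_firstCol] at hc1 hc2
      exact hc1 (h2 0 (YoungDiagram.mem_iff_lt_colLen.2 (h ▸ h1)) ⟨i', hc3, hc2⟩)
  · rintro ⟨⟨h1, h2⟩, h3⟩
    refine ⟨h1, ?_⟩
    rintro (_ | j) hj ⟨i', hi', hm⟩
    · rcases h3 with h3 | h3
      · exact mem_firstCol.1 h3
      · exact absurd (h3 i' (mem_firstCol.2 hm)) (not_le.2 hi')
    · rw [← mem_ones_tailCols] at hm ⊢
      exact h2 j (YoungDiagram.mem_tailCols.2 hj) ⟨i', hi', hm⟩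

end PermutationTableau

/-! ### The generating function of tableaux. -/

open Classical in
/-- Count the subsets `S` of `U` by the number of elements of `U` that belong to `S` or have no
element of `S` below them. -/
lemma sum_powerset_nonempty_pow_card_filter {R : Type*} [CommRing R] (x : R) (U : Finset ℕ) :
    ∑ S ∈ U.powerset.filter (fun S => S.Nonempty),
      x ^ (U.filter fun i => i ∈ S ∨ ∀ i' ∈ S, i ≤ i').card =
    x * ((x + 1) ^ U.card - x ^ U.card) := by
  -- Inserting the largest element `a` does not affect the status of smaller ones, and for nonempty
  -- `S` it is counted only if chosen. The choice `{a}`, arising from `S = ∅`, counts every element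
  -- and gives the extra term.
  induction U using Finset.induction_on_max with
  | empty =>
    rw [Finset.powerset_empty, Finset.filter_singleton]
    simp
  | insert a U hlt ih =>
    have ha : a ∉ U := fun h => lt_irrefl _ (hlt a h)
    rw [Finset.sum_filter] at ih ⊢
    rw [Finset.sum_powerset_insert ha, Finset.card_insert_of_notMem ha]
    have h1 : ∀ S ∈ U.powerset, (if S.Nonempty then
        x ^ ((insert a U).filter fun i => i ∈ S ∨ ∀ i' ∈ S, i ≤ i').card else 0) =
        if S.Nonempty then x ^ (U.filter fun i => i ∈ S ∨ ∀ i' ∈ S, i ≤ i').card else 0 := by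
      intro S hS
      rw [Finset.mem_powerset] at hS
      split_ifs with hne
      · rw [Finset.filter_insert, if_neg]
        rintro (h | h)
        · exact ha (hS h)
        · obtain ⟨b, hb⟩ := hne
          exact absurd (h b hb) (not_le.2 (hlt b (hS hb)))
      · rfl
    have h2 : ∀ S ∈ U.powerset, (if (insert a S).Nonempty then
        x ^ ((insert a U).filter fun i => i ∈ insert a S ∨ ∀ i' ∈ insert a S, i ≤ i').card else 0) =
        x * (if S.Nonempty then x ^ (U.filter fun i => i ∈ S ∨ ∀ i' ∈ S, i ≤ i').card else 0) +
        if S = ∅ then x ^ (U.card + 1) else 0 := by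
      intro S hS
      rw [Finset.mem_powerset] at hS
      rw [if_pos (Finset.insert_nonempty a S), Finset.filter_insert,
        if_pos (Or.inl (Finset.mem_insert_self a S)), Finset.card_insert_of_notMem (by simp [ha])]
      have h3 : (U.filter fun i => i ∈ insert a S ∨ ∀ i' ∈ insert a S, i ≤ i') =
          U.filter fun i => i ∈ S ∨ ∀ i' ∈ S, i ≤ i' := by
        refine Finset.filter_congr fun i hi => ?_
        have := hlt i hi
        simp [this.ne, this.le]
      rw [h3]
      rcases S.eq_empty_or_nonempty with rfl | hne
      · simp
      · rw [if_pos hne, if_neg hne.ne_empty]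
        ring
    rw [Finset.sum_congr rfl h1, Finset.sum_congr rfl h2, Finset.sum_add_distrib,
      ← Finset.mul_sum, ih, Finset.sum_ite_eq' U.powerset ∅]
    simp only [Finset.empty_mem_powerset, if_true]
    ring

namespace PermutationTableau

open PowerSeries

/-- The generating function of the permutation tableaux of length `n` by the numbers of
unrestricted rows and of columns. -/
noncomputable def genFun (n : ℕ) (x : ℝ⟦X⟧) : ℝ⟦X⟧ :=
  ∑ T ∈ (finite_ofLength n).toFinset, x ^ T.unrestrictedRows.card * X ^ T.numCols

lemma numCols_eq_zero_of_numRows {T : PermutationTableau} (h : T.numRows = 0) :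
    T.numCols = 0 := by
  by_contra hc
  have := T.lt_numRows (YoungDiagram.mem_iff_lt_rowLen.2 (Nat.pos_of_ne_zero hc))
  omega

lemma genFun_zero (x : ℝ⟦X⟧) : genFun 0 x = 1 := by
  have key : ∀ T ∈ (finite_ofLength 0).toFinset,
      x ^ T.unrestrictedRows.card * X ^ T.numCols = (1 : ℝ⟦X⟧) := by
    intro T hT
    have h : T.numRows + T.numCols = 0 := by simpa [ofLength, length] using hT
    have h1 : T.unrestrictedRows = ∅ := by
      ext i
      simp [mem_unrestrictedRows, (Nat.add_eq_zero_iff.1 h).1]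
    rw [h1, (Nat.add_eq_zero_iff.1 h).2]
    simp
  rw [genFun, Finset.sum_congr rfl key, Finset.sum_const]
  suffices (finite_ofLength 0).toFinset.card = 1 by rw [this, one_smul]
  obtain ⟨T, hT⟩ := nonempty_ofLength 0
  refine Finset.card_eq_one.2 ⟨T, Finset.eq_singleton_iff_unique_mem.2 ⟨by simpa using hT, ?_⟩⟩
  have aux : ∀ S ∈ ofLength 0, ∀ c, c ∉ S.shape.cells := by
    intro S hS c hc
    have h := S.mem_range_of_mem_shape hc
    rw [show S.length = 0 from hS] at h
    simp at h
  intro S hS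
  replace hS : S ∈ ofLength 0 := by simpa using hS
  refine PermutationTableau.ext ?_ ?_ ?_
  · exact YoungDiagram.ext (by
      rw [Finset.eq_empty_of_forall_notMem (aux S hS), Finset.eq_empty_of_forall_notMem (aux T hT)])
  · have h1 : S.numRows + S.numCols = 0 := hS
    have h2 : T.numRows + T.numCols = 0 := hT
    omega
  · rw [Finset.eq_empty_of_forall_notMem fun c hc => aux S hS c (S.ones_subset hc),
      Finset.eq_empty_of_forall_notMem fun c hc => aux T hT c (T.ones_subset hc)]

/-- Such tableaux arise uniquely from `addRow`; the added empty row is vacuously unrestricted and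
contributes the factor `x`. -/
lemma sum_of_colLen_lt (n : ℕ) (x : ℝ⟦X⟧) :
    ∑ T ∈ (finite_ofLength (n + 1)).toFinset.filter (fun T => T.shape.colLen 0 < T.numRows),
      x ^ T.unrestrictedRows.card * X ^ T.numCols = x * genFun n x := by
  rw [genFun, Finset.mul_sum]
  symm
  refine Finset.sum_bij (fun T _ => T.addRow) ?_ ?_ ?_ ?_
  · intro T hT
    have h : T.numRows + T.numCols = n := by simpa [ofLength, length] using hT
    have h' : T.addRow.length = n + 1 := by
      change T.numRows + 1 + T.numCols = n + 1
      omega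
    exact Finset.mem_filter.2 ⟨by simpa [ofLength] using h',
      Nat.lt_succ_iff.2 T.colLen_le_numRows⟩
  · intro S _ T _ h
    exact PermutationTableau.ext (congrArg shape h :)
      (Nat.succ_injective (congrArg numRows h :))
      (congrArg ones h :)
  · intro T hT
    obtain ⟨h1, h2⟩ := Finset.mem_filter.1 hT
    replace h1 : T.numRows + T.numCols = n + 1 := by simpa [ofLength, length] using h1
    refine ⟨{ T with numRows := T.numRows - 1, colLen_le_numRows := by omega }, ?_, ?_⟩
    · simp only [ofLength, Set.Finite.mem_toFinset, Set.mem_ofPred_eq, length]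
      change T.numRows - 1 + T.numCols = n
      omega
    · exact PermutationTableau.ext rfl (Nat.sub_add_cancel (by omega)) rfl
  · intro T _
    rw [card_unrestrictedRows_addRow, pow_succ']
    change _ = _ * X ^ T.numCols
    ring

-- The pair (`tailCols`, `firstCol`) is a bijection onto shorter tableaux with a nonempty set of
-- unrestricted rows; summing over these sets is `sum_powerset_nonempty_pow_card_filter`.
open Classical in
lemma sum_of_not_colLen_lt (n : ℕ) (x : ℝ⟦X⟧) :
    ∑ T ∈ (finite_ofLength (n + 1)).toFinset.filter (fun T => ¬ T.shape.colLen 0 < T.numRows),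
      x ^ T.unrestrictedRows.card * X ^ T.numCols =
    x * X * (genFun n (x + 1) - genFun n x) := by
  have h0 : x * X * (genFun n (x + 1) - genFun n x) =
      ∑ T ∈ (finite_ofLength n).toFinset,
        ∑ S ∈ T.unrestrictedRows.powerset.filter (fun S => S.Nonempty),
          x ^ (T.unrestrictedRows.filter fun i => i ∈ S ∨ ∀ i' ∈ S, i ≤ i').card *
            X ^ (T.numCols + 1) := by
    rw [genFun, genFun, ← Finset.sum_sub_distrib, Finset.mul_sum]
    refine Finset.sum_congr rfl fun T _ => ?_
    rw [← Finset.sum_mul, sum_powerset_nonempty_pow_card_filter]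
    ring
  rw [h0, Finset.sum_sigma']
  -- Positive length matters here: with no empty row, it forces a column to exist.
  have aux : ∀ T : PermutationTableau, T ∈ (finite_ofLength (n + 1)).toFinset.filter
      (fun T => ¬ T.shape.colLen 0 < T.numRows) →
      T.numRows + T.numCols = n + 1 ∧ T.shape.colLen 0 = T.numRows ∧ 0 < T.numCols := by
    intro T hT
    obtain ⟨h1, h2⟩ := Finset.mem_filter.1 hT
    replace h1 : T.numRows + T.numCols = n + 1 := by simpa [ofLength, length] using h1
    have h3 : T.shape.colLen 0 = T.numRows := le_antisymm T.colLen_le_numRows (not_lt.1 h2)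
    refine ⟨h1, h3, ?_⟩
    have h4 : T.numRows ≠ 0 := fun h => by
      have := numCols_eq_zero_of_numRows h
      omega
    exact YoungDiagram.mem_iff_lt_rowLen.1 (YoungDiagram.mem_iff_lt_colLen.2 (by omega))
  refine Finset.sum_bij (fun T _ => ⟨T.tailCols, T.firstCol⟩) ?_ ?_ ?_ ?_
  · intro T hT
    obtain ⟨h1, h2, h3⟩ := aux T hT
    refine Finset.mem_sigma.2 ⟨?_, Finset.mem_filter.2
      ⟨Finset.mem_powerset.2 T.firstCol_subset, T.firstCol_nonempty h3⟩⟩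
    simp only [ofLength, Set.Finite.mem_toFinset, Set.mem_ofPred_eq, length, numCols_tailCols]
    change T.numRows + (T.numCols - 1) = n
    omega
  · intro S hS T hT h
    simp only [Sigma.mk.injEq, heq_eq_eq] at h
    exact eq_of_tailCols_eq (aux S hS).2.1 (aux T hT).2.1 h.1 h.2
  · rintro ⟨T, S⟩ h
    obtain ⟨h1, h2⟩ := Finset.mem_sigma.1 h
    obtain ⟨h2, h3⟩ := Finset.mem_filter.1 h2
    replace h1 : T.numRows + T.numCols = n := by simpa [ofLength, length] using h1
    refine ⟨T.consCol S (Finset.mem_powerset.1 h2) h3, Finset.mem_filter.2 ⟨?_, ?_⟩, ?_⟩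
    · simp only [ofLength, Set.Finite.mem_toFinset, Set.mem_ofPred_eq, length, numCols_consCol]
      change T.numRows + (T.numCols + 1) = n + 1
      omega
    · rw [colLen_consCol]
      exact lt_irrefl _
    · simp only [tailCols_consCol, firstCol_consCol]
  · intro T hT
    obtain ⟨h1, h2, h3⟩ := aux T hT
    rw [unrestrictedRows_eq_filter T h2, numCols_tailCols, Nat.sub_add_cancel h3]

lemma genFun_succ (n : ℕ) (x : ℝ⟦X⟧) :
    genFun (n + 1) x = x * ((1 - X) * genFun n x + X * genFun n (x + 1)) := by
  rw [genFun, ← Finset.sum_filter_add_sum_filter_not _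
    (fun T : PermutationTableau => T.shape.colLen 0 < T.numRows), sum_of_colLen_lt,
    sum_of_not_colLen_lt]
  ring

/-- The recurrence shifts `x` by one, so the induction must treat all `d` at once. The base case is
the binomial series of `(1 - X)^(-(d+1))`. -/
lemma genFun_natCast (n d : ℕ) :
    genFun n ((d + 1 : ℕ) : ℝ⟦X⟧) = (1 - X) ^ (n + d + 1) *
      PowerSeries.mk fun m => ((d + m).choose d : ℝ) * ((d + 1 + m : ℕ) : ℝ) ^ n := by
  induction n generalizing d with
  | zero =>
    have h := (invOneSubPow ℝ (d + 1)).inv_val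
    rw [invOneSubPow_inv_eq_one_sub_pow, invOneSubPow_val_succ_eq_mk_add_choose] at h
    simpa [genFun_zero] using h.symm
  | succ n ih =>
    have h := ih (d + 1)
    rw [show ((d + 1 + 1 : ℕ) : ℝ⟦X⟧) = ((d + 1 : ℕ) : ℝ⟦X⟧) + 1 by push_cast; ring] at h
    rw [genFun_succ, ih, h]
    have key : ((d + 1 : ℕ) : ℝ⟦X⟧) *
        ((PowerSeries.mk fun m => ((d + m).choose d : ℝ) * ((d + 1 + m : ℕ) : ℝ) ^ n) +
        X * PowerSeries.mk fun m => ((d + 1 + m).choose (d + 1) : ℝ) *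
          ((d + 1 + 1 + m : ℕ) : ℝ) ^ n) =
        PowerSeries.mk fun m => ((d + m).choose d : ℝ) * ((d + 1 + m : ℕ) : ℝ) ^ (n + 1) := by
      rw [← map_natCast (PowerSeries.C (R := ℝ))]
      ext m
      rw [coeff_C_mul, map_add, coeff_mk, coeff_mk]
      rcases m with _ | m
      · simp [pow_succ']
      · rw [coeff_succ_X_mul, coeff_mk]
        -- After this absorption identity, the two terms combine through `(d + 1) + (m + 1)`, which
        -- supplies the missing power.
        have h1 : ((d + 1 + m).choose (d + 1) : ℝ) * (d + 1) =
            ((d + (m + 1)).choose d : ℝ) * (m + 1) := by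
          have := Nat.choose_succ_right_eq (d + 1 + m) d
          rw [show d + 1 + m - d = m + 1 by omega] at this
          rw [show d + (m + 1) = d + 1 + m by ring]
          exact_mod_cast this
        rw [show d + 1 + 1 + m = d + 1 + (m + 1) by ring]
        push_cast
        rw [pow_succ]
        linear_combination ((d : ℝ) + 1 + (m + 1)) ^ n * h1
    rw [← key]
    ring

/-- The generating function of the number of columns. -/
lemma sum_X_pow_numCols (n : ℕ) :
    ∑ T ∈ (finite_ofLength n).toFinset, (X : ℝ⟦X⟧) ^ T.numCols =
      (1 - X) ^ (n + 1) * PowerSeries.mk fun m => ((m + 1 : ℕ) : ℝ) ^ n := by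
  have h := genFun_natCast n 0
  simp only [genFun, zero_add, Nat.cast_one, one_pow, one_mul, Nat.choose_zero_right,
    add_zero] at h
  rw [h]
  simp [add_comm]

end PermutationTableau

/-! ### The generating function of descents. -/

namespace RandomPermutation

open PowerSeries

lemma descents_eq {n : ℕ} (σ : Equiv.Perm (Fin (n + 1))) :
    descents σ = ∑ i : Fin n, if σ i.succ < σ i.castSucc then 1 else 0 := by
  classical
  have h : ∀ i : Fin n, (∃ j : Fin (n + 1), j.val = i.castSucc.val + 1 ∧ σ j < σ i.castSucc) ↔
      σ i.succ < σ i.castSucc := fun i =>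
    ⟨fun ⟨j, hj, h⟩ => by rwa [show i.succ = j from Fin.ext hj.symm], fun h => ⟨i.succ, rfl, h⟩⟩
  have h' : ¬ ∃ j : Fin (n + 1), j.val = (Fin.last n).val + 1 ∧ σ j < σ (Fin.last n) := by
    rintro ⟨j, hj, -⟩
    rw [Fin.val_last] at hj
    exact absurd j.isLt (by omega)
  rw [descents, Finset.card_filter, Fin.sum_univ_castSucc, if_neg h', add_zero]
  simp only [h]

lemma ascents_eq_descents_rev {n : ℕ} (σ : Equiv.Perm (Fin n)) :
    ascents σ = descents (σ.trans Fin.revPerm) := by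
  simp [ascents, descents]

lemma descents_add_ascents {n : ℕ} (σ : Equiv.Perm (Fin (n + 1))) :
    descents σ + ascents σ = n := by
  rw [ascents_eq_descents_rev, descents_eq, descents_eq, ← Finset.sum_add_distrib]
  have h : ∀ i : Fin n, ((if σ i.succ < σ i.castSucc then 1 else 0) +
      if (σ.trans Fin.revPerm) i.succ < (σ.trans Fin.revPerm) i.castSucc then 1 else 0) = 1 := by
    intro i
    have hne : σ i.succ ≠ σ i.castSucc := fun h =>
      (Fin.castSucc_lt_succ (i := i)).ne' (σ.injective h)
    simp only [Equiv.trans_apply, Fin.revPerm_apply, Fin.rev_lt_rev]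
    rcases lt_or_gt_of_ne hne with h | h
    · simp [h, h.le]
    · simp [h, h.le]
  rw [Finset.sum_congr rfl fun i _ => h i]
  simp

/-- The permutation with first value `p` whose further values are in the relative order `τ`. -/
noncomputable def prepend {n : ℕ} (p : Fin (n + 1)) (τ : Equiv.Perm (Fin n)) :
    Equiv.Perm (Fin (n + 1)) :=
  Equiv.ofBijective (Fin.cons p fun i => p.succAbove (τ i) : Fin (n + 1) → Fin (n + 1))
    (Finite.injective_iff_bijective.1 (Fin.cons_injective_iff.2
      ⟨by simp [Fin.succAbove_ne], Fin.succAbove_right_injective.comp τ.injective⟩))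

lemma prepend_zero {n : ℕ} (p : Fin (n + 1)) (τ : Equiv.Perm (Fin n)) : prepend p τ 0 = p := rfl

lemma prepend_succ {n : ℕ} (p : Fin (n + 1)) (τ : Equiv.Perm (Fin n)) (i : Fin n) :
    prepend p τ i.succ = p.succAbove (τ i) := rfl

lemma prepend_bijective (n : ℕ) : Function.Bijective
    (fun a : Fin (n + 1) × Equiv.Perm (Fin n) => prepend a.1 a.2) := by
  rw [Fintype.bijective_iff_injective_and_card]
  constructor
  · rintro ⟨p, τ⟩ ⟨q, ρ⟩ h
    replace h : prepend p τ = prepend q ρ := h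
    obtain rfl : p = q := by rw [← prepend_zero p τ, h, prepend_zero]
    refine Prod.ext rfl (Equiv.ext fun i => ?_)
    apply Fin.succAbove_right_injective (p := p)
    rw [← prepend_succ, h, prepend_succ]
  · rw [Fintype.card_prod, Fintype.card_perm, Fintype.card_perm, Fintype.card_fin,
      Fintype.card_fin, Nat.factorial_succ]

/-- `p.succAbove` is increasing, so later descents are unchanged; it sends `τ 0` below `p` exactly
when `τ 0` is smaller than `p` as a number. -/
lemma descents_prepend {n : ℕ} (p : Fin (n + 2)) (τ : Equiv.Perm (Fin (n + 1))) :
    descents (prepend p τ) = (if (τ 0).val < p.val then 1 else 0) + descents τ := by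
  rw [descents_eq, descents_eq, Fin.sum_univ_succ]
  congr 1
  · rw [prepend_succ, Fin.castSucc_zero, prepend_zero]
    simp only [Fin.succAbove_lt_iff_castSucc_lt]
    rfl
  · refine Finset.sum_congr rfl fun i _ => ?_
    rw [← Fin.succ_castSucc, prepend_succ, prepend_succ]
    simp only [(Fin.strictMono_succAbove p).lt_iff_lt]

/-- The generating function by descents of the permutations with first value `p`. -/
noncomputable def genFunFirst (n : ℕ) (p : Fin (n + 1)) : ℝ⟦X⟧ :=
  ∑ τ : Equiv.Perm (Fin n), X ^ descents (prepend p τ)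

lemma sum_X_pow_descents_succ (n : ℕ) :
    ∑ σ : Equiv.Perm (Fin (n + 1)), (X : ℝ⟦X⟧) ^ descents σ = ∑ p, genFunFirst n p := by
  rw [← (prepend_bijective n).sum_comp, Fintype.sum_prod_type]
  rfl

lemma genFunFirst_succ (n : ℕ) (p : Fin (n + 2)) :
    genFunFirst (n + 1) p =
      ∑ q : Fin (n + 1), (if q.val < p.val then X else 1) * genFunFirst n q := by
  rw [genFunFirst, ← (prepend_bijective n).sum_comp, Fintype.sum_prod_type]
  refine Finset.sum_congr rfl fun q _ => ?_
  rw [genFunFirst, Finset.mul_sum]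
  refine Finset.sum_congr rfl fun τ _ => ?_
  rw [descents_prepend, prepend_zero, pow_add]
  split_ifs <;> simp

lemma sum_range_ite_mul_sub {R : Type*} [CommRing R] (x : R) (B : ℕ → R) (p N : ℕ) :
    ∑ q ∈ Finset.range N, (if q < p then x else 1) * (B q - B (q + 1)) =
      x * (B 0 - B (min N p)) + (B (min N p) - B N) := by
  induction N with
  | zero => simp
  | succ N ih =>
    rw [Finset.sum_range_succ, ih]
    split_ifs with h
    · rw [min_eq_left h.le, min_eq_left (Nat.succ_le_of_lt h)]
      ring
    · rw [min_eq_right (not_lt.1 h), min_eq_right (by omega)]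
      ring

/-- Since `(m + 1) - m = 1`, the series for `n` are consecutive differences of the series `B q` for
`n + 1`, so the recurrence telescopes on each side of `p`. The boundary terms cancel by `X * B 0 = B
(n + 1)`. -/
lemma genFunFirst_eq (n : ℕ) (p : Fin (n + 1)) :
    genFunFirst n p = (1 - X) ^ (n + 1) *
      PowerSeries.mk fun m => (m : ℝ) ^ p.val * ((m : ℝ) + 1) ^ (n - p.val) := by
  induction n with
  | zero =>
    have h := PowerSeries.mk_one_mul_one_sub_eq_one ℝ
    obtain rfl : p = 0 := Fin.fin_one_eq_zero p
    have h1 : genFunFirst 0 0 = 1 := by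
      simp [genFunFirst, descents_eq]
    rw [h1]
    refine h.symm.trans ?_
    rw [mul_comm]
    congr 1
    · simp
    · ext m
      simp
  | succ n ih =>
    set B : ℕ → ℝ⟦X⟧ := fun q =>
      PowerSeries.mk fun m => (m : ℝ) ^ q * ((m : ℝ) + 1) ^ (n + 1 - q) with hB
    have hsub : ∀ q ≤ n, (PowerSeries.mk fun m => (m : ℝ) ^ q * ((m : ℝ) + 1) ^ (n - q)) =
        B q - B (q + 1) := by
      intro q hq
      ext m
      rw [hB, map_sub, coeff_mk, coeff_mk, coeff_mk, show n + 1 - q = n - q + 1 by omega,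
        show n + 1 - (q + 1) = n - q by omega]
      ring
    have hX : X * B 0 = B (n + 1) := by
      ext m
      rcases m with _ | m
      · simp [hB]
      · simp [hB, coeff_succ_X_mul]
    rw [genFunFirst_succ]
    have h1 : ∀ q : Fin (n + 1), (if q.val < p.val then X else 1) * genFunFirst n q =
        (1 - X) ^ (n + 1) * ((if q.val < p.val then X else 1) * (B q - B (q + 1))) := by
      intro q
      rw [ih, hsub q (by omega)]
      ring
    rw [Finset.sum_congr rfl fun q _ => h1 q, ← Finset.mul_sum,
      Fin.sum_univ_eq_sum_range (fun q => (if q < p.val then X else 1) * (B q - B (q + 1))),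
      sum_range_ite_mul_sub, min_eq_right (by omega)]
    change _ = (1 - X) ^ (n + 1 + 1) * B p
    rw [← hX]
    ring

/-- The generating function of the number of descents. -/
lemma sum_X_pow_descents (n : ℕ) :
    ∑ σ : Equiv.Perm (Fin n), (X : ℝ⟦X⟧) ^ descents σ =
      (1 - X) ^ (n + 1) * PowerSeries.mk fun m => ((m + 1 : ℕ) : ℝ) ^ n := by
  rcases n with _ | n
  · have h := genFunFirst_eq 0 0
    have h1 : genFunFirst 0 0 = 1 := by simp [genFunFirst, descents_eq]
    rw [h1] at h
    simpa [descents] using h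
  -- Prepending the smallest value creates no descent.
  · have h : ∑ p, genFunFirst n p = genFunFirst (n + 1) 0 := by
      rw [genFunFirst_succ]
      simp
    rw [sum_X_pow_descents_succ, h, genFunFirst_eq]
    simp

end RandomPermutation

/-! ### From equal coefficients to equal laws. -/

namespace PowerSeries

lemma coeff_sum_X_pow {α : Type*} (s : Finset α) (f : α → ℕ) (k : ℕ) :
    coeff k (∑ a ∈ s, (X : ℝ⟦X⟧) ^ f a) = ((s.filter fun a => f a = k).card : ℝ) := by
  rw [map_sum, Finset.card_filter]
  push_cast
  refine Finset.sum_congr rfl fun a _ => ?_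
  rw [coeff_X_pow]
  simp only [eq_comm]

end PowerSeries

namespace ProbabilityTheory

lemma uniformOn_preimage_finset {α γ : Type*} [MeasurableSpace α] [DiscreteMeasurableSpace α]
    [DecidableEq γ] (s : Finset α) (f : α → γ) (c : γ) :
    uniformOn (s : Set α) (f ⁻¹' {c}) =
      ((s.filter fun a => f a = c).card : ENNReal) / s.card := by
  classical
  rw [← uniformOn_inter_self s.finite_toSet]
  have h : (s : Set α) ∩ f ⁻¹' {c} = ((s.filter fun a => f a = c : Finset α) : Set α) := by
    ext a
    simp
  rw [h, uniformOn_apply_finset, Finset.inter_eq_right.2 (Finset.filter_subset _ _)]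

lemma identDistrib_uniformOn {α β γ : Type*} [MeasurableSpace α] [DiscreteMeasurableSpace α]
    [MeasurableSpace β] [DiscreteMeasurableSpace β] [MeasurableSpace γ] [DecidableEq γ]
    [Countable γ] [MeasurableSingletonClass γ]
    (s : Finset α) (t : Finset β) (f : α → γ) (g : β → γ)
    (h : ∀ c, (s.filter fun a => f a = c).card = (t.filter fun b => g b = c).card) :
    IdentDistrib f g (uniformOn (s : Set α)) (uniformOn (t : Set β)) where
  aemeasurable_fst := (Measurable.of_discrete).aemeasurable
  aemeasurable_snd := (Measurable.of_discrete).aemeasurable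
  map_eq := by
    -- Equal fibres also force equal totals, hence equal normalizations.
    have hcard : s.card = t.card := by
      rw [Finset.card_eq_sum_card_fiberwise (f := f) (t := s.image f ∪ t.image g)
          fun a ha => Finset.mem_union_left _ (Finset.mem_image_of_mem f ha),
        Finset.card_eq_sum_card_fiberwise (f := g) (t := s.image f ∪ t.image g)
          fun b hb => Finset.mem_union_right _ (Finset.mem_image_of_mem g hb)]
      exact Finset.sum_congr rfl fun c _ => h c
    refine Measure.ext_of_singleton fun c => ?_
    rw [Measure.map_apply Measurable.of_discrete (measurableSet_singleton c),
      Measure.map_apply Measurable.of_discrete (measurableSet_singleton c),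
      uniformOn_preimage_finset, uniformOn_preimage_finset, h, hcard]

end ProbabilityTheory

lemma identDistrib_numCols_descents (n : ℕ) :
    IdentDistrib (fun T : PermutationTableau => T.numCols)
      (fun σ : Equiv.Perm (Fin n) => RandomPermutation.descents σ)
      (PermutationTableau.uniformMeasure n) (RandomPermutation.uniformMeasure n) := by
  have h := identDistrib_uniformOn (PermutationTableau.finite_ofLength n).toFinset
    (Finset.univ : Finset (Equiv.Perm (Fin n))) (fun T : PermutationTableau => T.numCols)
    (fun σ => RandomPermutation.descents σ) fun k => by
      have := congrArg (PowerSeries.coeff k) ((PermutationTableau.sum_X_pow_numCols n).trans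
        (RandomPermutation.sum_X_pow_descents n).symm)
      rw [PowerSeries.coeff_sum_X_pow, PowerSeries.coeff_sum_X_pow] at this
      exact_mod_cast this
  rwa [Set.Finite.coe_toFinset, Finset.coe_univ] at h

lemma identDistrib_descents_ascents (n : ℕ) :
    IdentDistrib (fun σ : Equiv.Perm (Fin n) => RandomPermutation.descents σ)
      (fun σ : Equiv.Perm (Fin n) => RandomPermutation.ascents σ)
      (RandomPermutation.uniformMeasure n) (RandomPermutation.uniformMeasure n) := by
  have h := identDistrib_uniformOn (Finset.univ : Finset (Equiv.Perm (Fin n)))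
    (Finset.univ : Finset (Equiv.Perm (Fin n))) (fun σ => RandomPermutation.descents σ)
    (fun σ => RandomPermutation.ascents σ) fun k => by
      symm
      refine Finset.card_bij (fun σ _ => σ.trans Fin.revPerm) ?_ ?_ ?_
      · intro σ hσ
        simpa [← RandomPermutation.ascents_eq_descents_rev] using hσ
      · intro σ _ τ _ h
        refine Equiv.ext fun i => ?_
        simpa using congrArg (fun ρ : Equiv.Perm (Fin n) => ρ i) h
      · intro σ hσ
        have : (σ.trans Fin.revPerm).trans Fin.revPerm = σ := by
          ext i
          simp
        refine ⟨σ.trans Fin.revPerm, ?_, this⟩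
        simpa [RandomPermutation.ascents_eq_descents_rev, this] using hσ
  rwa [Finset.coe_univ] at h

/-- At length `n + 1`, columns are distributed as ascents, that is, as `n` minus descents, hence as
`n` minus columns, which is almost surely rows minus one. -/
lemma identDistrib_numCols_numRows {n : ℕ} (hn : 1 ≤ n) :
    IdentDistrib (fun T : PermutationTableau => (T.numCols : ℤ))
      (fun T : PermutationTableau => (T.numRows : ℤ) - 1)
      (PermutationTableau.uniformMeasure n) (PermutationTableau.uniformMeasure n) := by
  obtain ⟨n, rfl⟩ := Nat.exists_eq_add_of_le' hn
  have h1 := identDistrib_numCols_descents (n + 1)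
  have h2 := h1.trans (identDistrib_descents_ascents (n + 1))
  have h3 := h2.comp (u := fun k : ℕ => (k : ℤ)) Measurable.of_discrete
  have h4 := h1.symm.comp (u := fun k : ℕ => (n : ℤ) - k) Measurable.of_discrete
  have h5 : (fun k : ℕ => (k : ℤ)) ∘ (fun σ : Equiv.Perm (Fin (n + 1)) =>
      RandomPermutation.ascents σ) = (fun k : ℕ => (n : ℤ) - k) ∘
      fun σ : Equiv.Perm (Fin (n + 1)) => RandomPermutation.descents σ := by
    funext σ
    have := RandomPermutation.descents_add_ascents σ
    simp only [Function.comp_apply]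
    omega
  rw [h5] at h3
  refine (h3.trans h4).trans (IdentDistrib.of_ae_eq Measurable.of_discrete.aemeasurable ?_)
  have h6 : ∀ᵐ T ∂PermutationTableau.uniformMeasure (n + 1),
      T ∈ PermutationTableau.ofLength (n + 1) := ae_cond_mem MeasurableSet.of_discrete
  filter_upwards [h6] with T hT
  have : T.numRows + T.numCols = n + 1 := hT
  simp only [Function.comp_apply]
  omega

/-! ### The Irwin–Hall distribution. -/

lemma sum_range_neg_one_pow_choose_succ {R : Type*} [CommRing R] (n : ℕ) (g : ℕ → R) :
    ∑ j ∈ Finset.range (n + 2), (-1) ^ j * ((n + 1).choose j : R) * g j =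
      ∑ j ∈ Finset.range (n + 1), (-1) ^ j * (n.choose j : R) * (g j - g (j + 1)) := by
  have h1 : ∑ j ∈ Finset.range (n + 1), (-1) ^ j * (n.choose j : R) * g j =
      ∑ j ∈ Finset.range (n + 2), (-1) ^ j * (n.choose j : R) * g j := by
    rw [Finset.sum_range_succ _ (n + 1)]
    simp
  simp only [mul_sub, Finset.sum_sub_distrib]
  rw [h1, Finset.sum_range_succ', Finset.sum_range_succ' _ (n + 1)]
  simp only [Nat.choose_succ_succ, Nat.choose_zero_right, pow_succ, Nat.cast_add]
  rw [← sub_eq_zero, ← sub_eq_zero.2 (Finset.sum_add_distrib (s := Finset.range (n + 1))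
    (f := fun j => (-1 : R) ^ j * -1 * (n.choose j : R) * g (j + 1))
    (g := fun j => (-1 : R) ^ j * -1 * (n.choose (j + 1) : R) * g (j + 1)))]
  simp only [mul_neg, mul_one, neg_mul, Finset.sum_neg_distrib, mul_add, add_mul,
    Finset.sum_add_distrib]
  ring

/-- The explicit formula for the cumulative distribution function of the sum of `n` independent
random variables with the uniform distribution on the unit interval. -/
noncomputable def irwinHallCDF (n : ℕ) (x : ℝ) : ℝ :=
  (∑ j ∈ Finset.range (n + 1), (-1) ^ j * (n.choose j : ℝ) * max (x - j) 0 ^ n) / n.factorial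

lemma continuous_max_zero_pow (n : ℕ) : Continuous fun t : ℝ => max t 0 ^ n := by fun_prop

/-- Right derivatives suffice for the fundamental theorem, which avoids a two-sided argument at the
kink `0`. The exponent must be positive because `0 ^ 0 = 1`. -/
lemma integral_max_zero_pow {n : ℕ} (hn : 1 ≤ n) (a b : ℝ) :
    ∫ t in a..b, max t 0 ^ n = max b 0 ^ (n + 1) / (n + 1) - max a 0 ^ (n + 1) / (n + 1) := by
  refine intervalIntegral.integral_eq_sub_of_hasDeriv_right
    (f := fun t : ℝ => max t 0 ^ (n + 1) / ((n : ℝ) + 1)) (by fun_prop) ?_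
    ((continuous_max_zero_pow n).intervalIntegrable _ _)
  intro t _
  rcases lt_or_ge t 0 with h | h
  · have h1 : (fun s : ℝ => max s 0 ^ (n + 1) / ((n : ℝ) + 1)) =ᶠ[nhds t] fun _ => 0 := by
      filter_upwards [gt_mem_nhds h] with s hs
      rw [max_eq_right hs.le]
      simp
    have h2 : max t 0 ^ n = 0 := by
      rw [max_eq_right h.le, zero_pow (by omega)]
    rw [h2]
    exact ((hasDerivAt_const t (0 : ℝ)).congr_of_eventuallyEq h1).hasDerivWithinAt
  · have h1 : HasDerivAt (fun s : ℝ => s ^ (n + 1) / ((n : ℝ) + 1)) (max t 0 ^ n) t := by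
      have h2 := (hasDerivAt_pow (n + 1) t).div_const ((n : ℝ) + 1)
      have h3 : (n : ℝ) + 1 ≠ 0 := by positivity
      have h4 : max t 0 ^ n = ((n + 1 : ℕ) : ℝ) * t ^ (n + 1 - 1) / ((n : ℝ) + 1) := by
        rw [max_eq_left h, Nat.add_sub_cancel]
        push_cast
        field_simp
      rw [h4]
      exact h2
    refine h1.hasDerivWithinAt.congr (fun s hs => ?_) ?_
    · rw [max_eq_left (h.trans (Set.mem_Ioi.1 hs).le)]
    · rw [max_eq_left h]

/-- Each truncated power integrates to a difference of truncated powers at consecutive shifts, and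
Pascal's rule collects these into the next binomial row. -/
lemma integral_irwinHallCDF {n : ℕ} (hn : 1 ≤ n) (x : ℝ) :
    ∫ u in (0 : ℝ)..1, irwinHallCDF n (x - u) = irwinHallCDF (n + 1) x := by
  have h1 : ∀ j : ℕ, ∫ u in (0 : ℝ)..1, max (x - u - j) 0 ^ n =
      (max (x - j) 0 ^ (n + 1) - max (x - (j + 1 : ℕ)) 0 ^ (n + 1)) / (n + 1) := by
    intro j
    have h2 : ∀ u : ℝ, max (x - u - j) 0 ^ n = (fun t : ℝ => max t 0 ^ n) ((x - j) - u) := by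
      intro u
      simp only
      congr 2
      ring
    simp only [h2]
    rw [intervalIntegral.integral_comp_sub_left (fun t : ℝ => max t 0 ^ n),
      integral_max_zero_pow hn]
    rw [show x - (j : ℝ) - 1 = x - (j + 1 : ℕ) by push_cast; ring, sub_zero, sub_div]
  simp only [irwinHallCDF]
  rw [intervalIntegral.integral_div, intervalIntegral.integral_finsetSum
    fun j _ => Continuous.intervalIntegrable (by fun_prop) _ _]
  simp only [intervalIntegral.integral_const_mul, h1]
  rw [sum_range_neg_one_pow_choose_succ n (fun j : ℕ => max (x - j) 0 ^ (n + 1)),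
    Nat.factorial_succ, Finset.sum_div, Finset.sum_div]
  refine Finset.sum_congr rfl fun j _ => ?_
  push_cast
  field_simp

lemma continuous_irwinHallCDF (n : ℕ) : Continuous (irwinHallCDF n) := by
  unfold irwinHallCDF
  fun_prop

/-- A sequence of independent random variables with the uniform distribution on the unit
interval. -/
noncomputable def iidUniform : Measure (ℕ → unitInterval) :=
  Measure.infinitePi fun _ => volume

instance : IsProbabilityMeasure iidUniform := by
  unfold iidUniform
  infer_instance

/-- The sum of the first `n` coordinates. -/
noncomputable def partialSum (n : ℕ) (ω : ℕ → unitInterval) : ℝ :=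
  ∑ i ∈ Finset.range n, (ω i : ℝ)

@[fun_prop]
lemma measurable_partialSum (n : ℕ) : Measurable (partialSum n) := by
  unfold partialSum
  fun_prop

lemma partialSum_nonneg (n : ℕ) (ω : ℕ → unitInterval) : 0 ≤ partialSum n ω :=
  Finset.sum_nonneg fun i _ => (ω i).2.1

lemma map_eval_iidUniform (n : ℕ) :
    iidUniform.map (fun ω => (ω n : ℝ)) = volume.restrict (Set.Icc 0 1) := by
  rw [← unitInterval.measurePreserving_coe.map_eq,
    ← (measurePreserving_eval_infinitePi (fun _ : ℕ => (volume : Measure unitInterval)) n).map_eq,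
    Measure.map_map (by fun_prop) (by fun_prop)]
  rfl

lemma iIndepFun_iidUniform : iIndepFun (fun (i : ℕ) (ω : ℕ → unitInterval) => (ω i : ℝ))
    iidUniform :=
  iIndepFun_infinitePi (P := fun _ : ℕ => (volume : Measure unitInterval))
    (X := fun _ x => (x : ℝ)) fun _ => measurable_subtype_coe

lemma measure_partialSum_succ_le (n : ℕ) (x : ℝ) :
    iidUniform {ω | partialSum (n + 1) ω ≤ x} =
      ∫⁻ u in Set.Icc (0 : ℝ) 1, iidUniform {ω | partialSum n ω ≤ x - u} := by
  have h1 : IndepFun (partialSum n) (fun ω : ℕ → unitInterval => (ω n : ℝ)) iidUniform := by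
    have h2 := iIndepFun_iidUniform.indepFun_sum_range_succ (fun i => by fun_prop) n
    convert h2 using 1
    funext ω
    simp [partialSum]
  have h3 := h1.map_prod_eq_prod_map_map (by fun_prop)
    (Measurable.aemeasurable (by fun_prop))
  rw [map_eval_iidUniform] at h3
  have hs : MeasurableSet {p : ℝ × ℝ | p.1 + p.2 ≤ x} :=
    measurableSet_le (by fun_prop) (by fun_prop)
  have h4 : {ω | partialSum (n + 1) ω ≤ x} =
      (fun ω : ℕ → unitInterval => (partialSum n ω, (ω n : ℝ))) ⁻¹' {p | p.1 + p.2 ≤ x} := by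
    ext ω
    simp [partialSum, Finset.sum_range_succ]
  rw [h4, ← Measure.map_apply (by fun_prop) hs, h3, Measure.prod_apply_symm hs]
  refine lintegral_congr fun u => ?_
  rw [Measure.map_apply (by fun_prop) (by measurability)]
  congr 1
  ext ω
  simp [le_sub_iff_add_le]

/-- Induction by conditioning on the last summand. It starts at `1`: for `n = 0` the formula is
constantly `1`, even at negative `x`. -/
lemma measureReal_partialSum_le {n : ℕ} (hn : 1 ≤ n) (x : ℝ) :
    iidUniform.real {ω | partialSum n ω ≤ x} = irwinHallCDF n x := by
  induction n, hn using Nat.le_induction generalizing x with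
  | base =>
    have h1 : {ω | partialSum 1 ω ≤ x} =
        (fun ω : ℕ → unitInterval => (ω 0 : ℝ)) ⁻¹' Set.Iic x := by
      ext ω
      simp [partialSum]
    rw [h1, ← map_measureReal_apply (by fun_prop) measurableSet_Iic, map_eval_iidUniform,
      measureReal_restrict_apply measurableSet_Iic, ← Set.Ici_inter_Iic,
      Set.inter_comm, Set.inter_assoc, Set.Iic_inter_Iic, Set.Ici_inter_Iic,
      Real.volume_real_Icc]
    simp only [irwinHallCDF, Finset.sum_range_succ, Finset.sum_range_zero]
    norm_num
    rcases le_total x 0 with h | h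
    · rw [min_eq_right (by linarith), max_eq_right h, max_eq_right (by linarith)]
      simp
    · rcases le_total x 1 with h' | h'
      · rw [min_eq_right h', max_eq_left h, max_eq_right (by linarith)]
        simp
      · rw [min_eq_left h', max_eq_left h, max_eq_left zero_le_one, max_eq_left (by linarith)]
        ring
  | succ n hn ih =>
    rw [measureReal_def, measure_partialSum_succ_le]
    have h1 : ∀ u : ℝ, iidUniform {ω | partialSum n ω ≤ x - u} =
        ENNReal.ofReal (irwinHallCDF n (x - u)) := by
      intro u
      rw [← ih, ofReal_measureReal]
    have h2 : ∀ u : ℝ, 0 ≤ irwinHallCDF n (x - u) := by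
      intro u
      rw [← ih]
      exact measureReal_nonneg
    simp only [h1]
    have hc : Continuous fun u : ℝ => irwinHallCDF n (x - u) :=
      (continuous_irwinHallCDF n).comp (by fun_prop)
    rw [← integral_eq_lintegral_of_nonneg_ae (Filter.Eventually.of_forall h2)
      hc.aestronglyMeasurable, integral_Icc_eq_integral_Ioc,
      ← intervalIntegral.integral_of_le zero_le_one, integral_irwinHallCDF hn]

/-! ### Descents as a rounded sum of uniform variables. -/

namespace PowerSeries

lemma coeff_sum_X_pow_mul_mk_one {α : Type*} (s : Finset α) (f : α → ℕ) (k : ℕ) :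
    coeff k ((∑ a ∈ s, (X : ℝ⟦X⟧) ^ f a) * mk 1) = ((s.filter fun a => f a ≤ k).card : ℝ) := by
  rw [Finset.sum_mul, map_sum, Finset.card_filter]
  push_cast
  refine Finset.sum_congr rfl fun a _ => ?_
  rw [coeff_X_pow_mul']
  simp

lemma coeff_one_sub_X_pow_mul {R : Type*} [CommRing R] (n k : ℕ) (F : R⟦X⟧) :
    coeff k ((1 - X) ^ n * F) = ∑ j ∈ Finset.range (n + 1),
      (-1) ^ j * (n.choose j : R) * if j ≤ k then coeff (k - j) F else 0 := by
  rw [sub_eq_neg_add, add_pow, Finset.sum_mul, map_sum]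
  refine Finset.sum_congr rfl fun j _ => ?_
  have : (-X : R⟦X⟧) ^ j * 1 ^ (n - j) * (n.choose j : R⟦X⟧) * F =
      C ((-1) ^ j * (n.choose j : R)) * (X ^ j * F) := by
    rw [neg_pow]
    simp only [map_mul, map_pow, map_neg, map_one, map_natCast, one_pow]
    ring
  rw [this, coeff_C_mul, coeff_X_pow_mul']

end PowerSeries

namespace RandomPermutation

/-- Multiplying by `∑ X^m` accumulates coefficients and cancels one factor `1 - X`; expanding the
remaining `(1 - X)^n` gives the Irwin–Hall sum. -/
lemma card_descents_le {n : ℕ} (hn : 1 ≤ n) (k : ℕ) :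
    ((Finset.univ.filter fun σ : Equiv.Perm (Fin n) => descents σ ≤ k).card : ℝ) =
      n.factorial * irwinHallCDF n ((k + 1 : ℕ) : ℝ) := by
  have h1 : (1 - PowerSeries.X : PowerSeries ℝ) ^ (n + 1) *
      (PowerSeries.mk fun m => ((m + 1 : ℕ) : ℝ) ^ n) * PowerSeries.mk 1 =
      (1 - PowerSeries.X) ^ n * PowerSeries.mk fun m => ((m + 1 : ℕ) : ℝ) ^ n := by
    linear_combination ((1 - PowerSeries.X : PowerSeries ℝ) ^ n *
      PowerSeries.mk fun m => ((m + 1 : ℕ) : ℝ) ^ n) * PowerSeries.mk_one_mul_one_sub_eq_one ℝ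
  rw [← PowerSeries.coeff_sum_X_pow_mul_mk_one, sum_X_pow_descents, h1,
    PowerSeries.coeff_one_sub_X_pow_mul, irwinHallCDF,
    mul_div_cancel₀ _ (Nat.cast_ne_zero.2 n.factorial_ne_zero)]
  refine Finset.sum_congr rfl fun j _ => ?_
  congr 1
  split_ifs with h
  · rw [PowerSeries.coeff_mk, show k - j + 1 = k + 1 - j by omega, Nat.cast_sub (by omega),
      max_eq_left]
    rw [sub_nonneg]
    exact_mod_cast (by omega : j ≤ k + 1)
  -- For `j > k` the truncated power vanishes, including the boundary case `j = k + 1`.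
  · rw [max_eq_right, zero_pow (by omega)]
    rw [sub_nonpos]
    exact_mod_cast (by omega : k + 1 ≤ j)

/-- The number of descents of a uniformly random permutation is distributed as the integer part
(almost surely equal to the ceiling minus one) of a sum of independent random variables with the
uniform distribution on the unit interval. -/
lemma identDistrib_descents_ceil {n : ℕ} (hn : 1 ≤ n) :
    IdentDistrib (fun σ : Equiv.Perm (Fin n) => descents σ)
      (fun ω => ⌈partialSum n ω⌉₊ - 1) (uniformMeasure n) iidUniform where
  aemeasurable_fst := Measurable.of_discrete.aemeasurable
  aemeasurable_snd := by fun_prop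
  map_eq := by
    have hm : Measurable fun ω => ⌈partialSum n ω⌉₊ - 1 := by fun_prop
    have : IsFiniteMeasure ((uniformMeasure n).map
      fun σ : Equiv.Perm (Fin n) => descents σ) := by infer_instance
    refine Measure.ext_of_Iic _ _ fun k => ?_
    rw [Measure.map_apply Measurable.of_discrete measurableSet_Iic,
      Measure.map_apply hm measurableSet_Iic]
    have h1 : (fun ω => ⌈partialSum n ω⌉₊ - 1) ⁻¹' Set.Iic k =
        {ω | partialSum n ω ≤ ((k + 1 : ℕ) : ℝ)} := by
      ext ω
      rw [Set.mem_preimage, Set.mem_Iic, Set.mem_ofPred_eq, ← Nat.ceil_le]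
      omega
    have h2 : (fun σ : Equiv.Perm (Fin n) => descents σ) ⁻¹' Set.Iic k =
        ((Finset.univ.filter fun σ : Equiv.Perm (Fin n) => descents σ ≤ k :
          Finset (Equiv.Perm (Fin n))) : Set (Equiv.Perm (Fin n))) := by
      ext σ
      simp
    rw [h1, ← ofReal_measureReal (μ := iidUniform), measureReal_partialSum_le hn, h2,
      uniformMeasure, ← Finset.coe_univ, uniformOn_apply_finset, Finset.univ_inter,
      Finset.card_univ, Fintype.card_perm, Fintype.card_fin]
    have h3 : irwinHallCDF n ((k + 1 : ℕ) : ℝ) =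
        ((Finset.univ.filter fun σ : Equiv.Perm (Fin n) => descents σ ≤ k).card : ℝ) /
          (n.factorial : ℝ) := by
      rw [card_descents_le hn, mul_div_cancel_left₀ _ (Nat.cast_ne_zero.2 n.factorial_ne_zero)]
    rw [h3, ENNReal.ofReal_div_of_pos (by exact_mod_cast n.factorial_pos),
      ENNReal.ofReal_natCast, ENNReal.ofReal_natCast]

end RandomPermutation

/-! ### The central limit theorem. -/

lemma integral_eval_iidUniform {f : ℝ → ℝ} (hf : Continuous f) (i : ℕ) :
    ∫ ω, f (ω i : ℝ) ∂iidUniform = ∫ u in (0 : ℝ)..1, f u := by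
  rw [← integral_map (φ := fun ω : ℕ → unitInterval => (ω i : ℝ))
    (Measurable.aemeasurable (by fun_prop)) hf.aestronglyMeasurable,
    map_eval_iidUniform, integral_Icc_eq_integral_Ioc,
    ← intervalIntegral.integral_of_le zero_le_one]

/-- A uniform variable has variance `1 / 12`, so `√12` normalizes the centred summands. -/
lemma tendstoInDistribution_partialSum :
    TendstoInDistribution
      (fun (n : ℕ) ω => (√(n : ℝ))⁻¹ * (√12 * (partialSum n ω - n / 2)))
      atTop (id : ℝ → ℝ) (fun _ => iidUniform) (gaussianReal 0 1) := by
  have h := tendstoInDistribution_inv_sqrt_mul_sum (P := iidUniform) (P' := gaussianReal 0 1)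
    (X := fun (i : ℕ) (ω : ℕ → unitInterval) => √12 * ((ω i : ℝ) - 1 / 2)) (Y := id)
    HasLaw.id ?_ ?_ ?_ ?_
  · convert h using 3 with n ω
    simp only [partialSum]
    rw [← Finset.mul_sum, Finset.sum_sub_distrib, Finset.sum_const, Finset.card_range,
      nsmul_eq_mul]
    ring
  · rw [integral_eval_iidUniform (f := fun u => √12 * (u - 1 / 2)) (by fun_prop),
      intervalIntegral.integral_const_mul, intervalIntegral.integral_sub (by simp) (by simp)]
    simp
  · have h1 : ∀ u : ℝ, (√12 * (u - 1 / 2)) ^ 2 = 12 * u ^ 2 - 12 * u + 3 := by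
      intro u
      rw [mul_pow, Real.sq_sqrt (by norm_num)]
      ring
    have h2 := integral_eval_iidUniform (f := fun u => (√12 * (u - 1 / 2)) ^ 2) (by fun_prop) 0
    refine h2.trans ?_
    simp only [h1]
    rw [intervalIntegral.integral_add (Continuous.intervalIntegrable (by fun_prop) _ _)
      (Continuous.intervalIntegrable (by fun_prop) _ _), intervalIntegral.integral_sub
      (Continuous.intervalIntegrable (by fun_prop) _ _)
      (Continuous.intervalIntegrable (by fun_prop) _ _),
      intervalIntegral.integral_const_mul, intervalIntegral.integral_const_mul]
    simp
    norm_num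
  · exact iIndepFun_iidUniform.comp (fun _ u => √12 * (u - 1 / 2)) (fun _ => by fun_prop)
  · intro i
    have h3 : IdentDistrib (fun ω : ℕ → unitInterval => (ω i : ℝ))
        (fun ω : ℕ → unitInterval => (ω 0 : ℝ)) iidUniform iidUniform :=
      ⟨Measurable.aemeasurable (by fun_prop), Measurable.aemeasurable (by fun_prop),
        by rw [map_eval_iidUniform, map_eval_iidUniform]⟩
    exact h3.comp (u := fun u => √12 * (u - 1 / 2)) (by fun_prop)

lemma abs_ceil_partialSum_sub_le (n : ℕ) (ω : ℕ → unitInterval) :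
    |((⌈partialSum n ω⌉₊ - 1 : ℕ) : ℝ) - partialSum n ω + 1 / 2| ≤ 1 / 2 := by
  -- At sum `0` the truncated subtraction gives `0`, not `-1`, and the bound is attained.
  rcases (partialSum_nonneg n ω).eq_or_lt with h | h
  · rw [← h]
    norm_num
  · have h1 := Nat.ceil_lt_add_one h.le
    have h2 := Nat.le_ceil (partialSum n ω)
    rw [Nat.cast_sub (Nat.ceil_pos.2 h), Nat.cast_one, abs_le]
    constructor <;> linarith

lemma tendstoInDistribution_ceil_partialSum :
    TendstoInDistribution
      (fun (n : ℕ) ω => (((⌈partialSum n ω⌉₊ - 1 : ℕ) : ℝ) - ((n : ℝ) - 1) / 2) /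
        √(((n : ℝ) + 1) / 12))
      atTop (id : ℝ → ℝ) (fun _ => iidUniform) (gaussianReal 0 1) := by
  have hn : Tendsto (fun n : ℕ => (n : ℝ) + 1) atTop atTop :=
    tendsto_atTop_add_const_right _ _ tendsto_natCast_atTop_atTop
  have hc : Tendsto (fun n : ℕ => √((n : ℝ) / ((n : ℝ) + 1))) atTop (nhds 1) := by
    have := (Real.continuous_sqrt.tendsto 1).comp (tendsto_natCast_div_add_atTop (1 : ℝ))
    rwa [Real.sqrt_one] at this
  have he : ∀ ω, Tendsto (fun n : ℕ => (((⌈partialSum n ω⌉₊ - 1 : ℕ) : ℝ) - partialSum n ω +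
      1 / 2) / √(((n : ℝ) + 1) / 12)) atTop (nhds 0) := by
    intro ω
    have h1 : Tendsto (fun n : ℕ => 1 / 2 / √(((n : ℝ) + 1) / 12)) atTop (nhds 0) :=
      (Real.tendsto_sqrt_atTop.comp (hn.atTop_div_const (by norm_num))).const_div_atTop _
    refine squeeze_zero_norm (fun n => ?_) h1
    rw [norm_div, Real.norm_eq_abs, Real.norm_of_nonneg (Real.sqrt_nonneg _)]
    exact div_le_div_of_nonneg_right (abs_ceil_partialSum_sub_le n ω) (Real.sqrt_nonneg _)
  have hmeas : ∀ n : ℕ, Measurable fun ω => (√((n : ℝ) / ((n : ℝ) + 1)),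
      (((⌈partialSum n ω⌉₊ - 1 : ℕ) : ℝ) - partialSum n ω + 1 / 2) / √(((n : ℝ) + 1) / 12)) := by
    intro n
    have : Measurable fun ω => ((⌈partialSum n ω⌉₊ - 1 : ℕ) : ℝ) :=
      (Measurable.of_discrete (f := fun k : ℕ => ((k - 1 : ℕ) : ℝ))).comp
        (measurable_partialSum n).nat_ceil
    fun_prop
  -- Slutsky: the target is the normalized sum times `√(n / (n + 1))`, which tends to `1`, plus the
  -- scaled rounding error, which tends to `0`. The shift `1 / 2` turns the centring `n / 2` into
  -- `(n - 1) / 2`.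
  have key := tendstoInDistribution_partialSum.continuous_comp_prodMk_of_tendstoInMeasure_const
    (g := fun p : ℝ × (ℝ × ℝ) => p.2.1 * p.1 + p.2.2) (c := ((1 : ℝ), (0 : ℝ))) (by fun_prop)
    (tendstoInMeasure_of_tendsto_ae (fun n => (hmeas n).aestronglyMeasurable)
      (Filter.Eventually.of_forall fun ω => hc.prodMk_nhds (he ω)))
    (fun n => (hmeas n).aemeasurable)
  convert key using 3 with n ω
  · simp only
    have h1 : √((n : ℝ) + 1) ≠ 0 := by positivity
    have h2 : √(12 : ℝ) ≠ 0 := by positivity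
    rw [Real.sqrt_div n.cast_nonneg, Real.sqrt_div (by positivity)]
    rcases n.eq_zero_or_pos with rfl | hpos
    · simp [partialSum]
      ring
    · have h3 : √(n : ℝ) ≠ 0 := by positivity
      field_simp
      ring
  · simp

lemma tendstoInDistribution_numCols :
    TendstoInDistribution
      (fun (n : ℕ) (T : PermutationTableau) =>
        ((T.numCols : ℝ) - ((n : ℝ) - 1) / 2) / √(((n : ℝ) + 1) / 12))
      atTop (id : ℝ → ℝ) PermutationTableau.uniformMeasure (gaussianReal 0 1) where
  forall_aemeasurable _ := Measurable.of_discrete.aemeasurable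
  tendsto := by
    refine tendstoInDistribution_ceil_partialSum.tendsto.congr' ?_
    filter_upwards [eventually_ge_atTop 1] with n hn
    have h := ((identDistrib_numCols_descents n).trans
      (RandomPermutation.identDistrib_descents_ceil hn)).comp
      (u := fun k : ℕ => ((k : ℝ) - ((n : ℝ) - 1) / 2) / √(((n : ℝ) + 1) / 12))
      Measurable.of_discrete
    exact Subtype.ext h.map_eq.symm

theorem mainTheorem9 :
    (∀ n : ℕ, 1 ≤ n →
      IdentDistrib (fun T : PermutationTableau => (T.numCols : ℤ))
        (fun T : PermutationTableau => (T.numRows : ℤ) - 1)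
        (PermutationTableau.uniformMeasure n) (PermutationTableau.uniformMeasure n) ∧
      IdentDistrib (fun T : PermutationTableau => T.numCols)
        (fun σ : Equiv.Perm (Fin n) => RandomPermutation.descents σ)
        (PermutationTableau.uniformMeasure n) (RandomPermutation.uniformMeasure n) ∧
      IdentDistrib (fun T : PermutationTableau => T.numCols)
        (fun σ : Equiv.Perm (Fin n) => RandomPermutation.ascents σ)
        (PermutationTableau.uniformMeasure n) (RandomPermutation.uniformMeasure n)) ∧
    TendstoInDistribution
      (fun (n : ℕ) (T : PermutationTableau) =>
        ((T.numCols : ℝ) - ((n : ℝ) - 1) / 2) / √(((n : ℝ) + 1) / 12))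
      atTop (id : ℝ → ℝ) PermutationTableau.uniformMeasure (gaussianReal 0 1) :=
  ⟨fun n hn => ⟨identDistrib_numCols_numRows hn, identDistrib_numCols_descents n,
    (identDistrib_numCols_descents n).trans (identDistrib_descents_ascents n)⟩,
    tendstoInDistribution_numCols⟩
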